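/- Let $V_6$ be a $6$-dimensional complex vector space, and let $\bigwedge^3V_6$ carry the $\bigwedge^6V_6$-valued symplectic form given by wedge product. Let $A\subset\bigwedge^3V_6$ be a Lagrangian subspace containing no nonzero decomposable vector $v_1\wedge v_2\wedge v_3$. Let $U_0\subset V_6$ be a $3$-dimensional subspace, set $T_{U_0}:=\bigwedge^2U_0\wedge V_6\subset\bigwedge^3V_6$ and $K:=A\cap T_{U_0}$, and assume that $k:=\dim K\in\{1,2,3,4\}$. Let $\mathscr C_{U_0}:=\mathbf P(T_{U_0})\cap \mathrm{Gr}(3,V_6)\subset \mathbf P(\bigwedge^3V_6)$ be the cone of decomposable vectors in $T_{U_0}$, let $H^0(\mathbf P(T_{U_0}),I_{\mathscr C_{U_0}}(2))$ be the space of quadratic forms on $T_{U_0}$ that vanish on $\mathscr C_{U_0}$, and let $$r_K\colon H^0(\mathbf P(T_{U_0}),I_{\mathscr C_{U_0}}(2))\longrightarrow H^0(\mathbf P(K),\mathscr O(2))\simeq \mathrm{Sym}^2K^\vee$$ be the restriction map $q\mapsto q|_K$. Then: (a) if $k\in\{1,2,3\}$, the map $r_K$ is surjective and its kernel has dimension $9-\frac{k(k+1)}2$;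 (b) if $k=4$, the map $r_K$ is injective and its image is a hyperplane in $\mathrm{Sym}^2K^\vee$; this hyperplane is the annihilator of an element of $\mathrm{Sym}^2K$ of maximal rank $4$, that is, of a nondegenerate symmetric tensor. -/

import Mathlib

open scoped TensorProduct

noncomputable section

namespace EPWCube

variable {V : Type*} [AddCommGroup V] [Module ℂ V]

/-- A trivector is decomposable if it is of the form `v₁ ∧ v₂ ∧ v₃` (zero is included). -/
def IsDecomposable (x : ⋀[ℂ]^3 V) : Prop :=
  ∃ v : Fin 3 → V, exteriorPower.ιMulti ℂ 3 v = x

/-- `A` contains no decomposable vectors, that is, `P(A)` does not meet the Grassmannian `Gr(3, V)`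
in its Plücker embedding. -/
def HasNoDecomposable (A : Submodule ℂ (⋀[ℂ]^3 V)) : Prop :=
  ∀ x ∈ A, IsDecomposable x → x = 0

/-- Lagrangian subspaces of `⋀³ V` for the `⋀⁶ V`-valued symplectic form given by wedge product
(computed in the exterior algebra): `A` is its own orthogonal. -/
def IsLagrangian (A : Submodule ℂ (⋀[ℂ]^3 V)) : Prop :=
  ∀ x : ⋀[ℂ]^3 V,
    x ∈ A ↔ ∀ y ∈ A, (x : ExteriorAlgebra ℂ V) * (y : ExteriorAlgebra ℂ V) = 0

/-- `T_U = ⋀² U ∧ V`, the span of the `u₁ ∧ u₂ ∧ v` with `u₁, u₂ ∈ U` and `v ∈ V`. -/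
def tangentSpace (U : Submodule ℂ V) : Submodule ℂ (⋀[ℂ]^3 V) :=
  Submodule.span ℂ
    {x | ∃ u₁ ∈ U, ∃ u₂ ∈ U, ∃ v : V, x = exteriorPower.ιMulti ℂ 3 ![u₁, u₂, v]}

/-- The subspace `K = A ∩ T_U` of `⋀³ V`. -/
abbrev interTangent (A : Submodule ℂ (⋀[ℂ]^3 V)) (U : Submodule ℂ V) :
    Submodule ℂ (⋀[ℂ]^3 V) :=
  A ⊓ tangentSpace U

/-- The stratum `Z^k_A` of `Gr(3, V)`: the three-dimensional `U` with `dim (A ∩ T_U) = k`. -/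
def stratum (A : Submodule ℂ (⋀[ℂ]^3 V)) (k : ℕ) : Set (Submodule ℂ V) :=
  {U | Module.finrank ℂ U = 3 ∧ Module.finrank ℂ (interTangent A U) = k}

/-- `H⁰(P(T_U), I_{C_U}(2))`: the quadratic forms on `T_U` that vanish on the cone
`C_U = P(T_U) ∩ Gr(3, V)`, that is, on all the decomposable vectors of `T_U`. -/
def quadricsThroughCone (U : Submodule ℂ V) : Submodule ℂ (QuadraticForm ℂ (tangentSpace U)) where
  carrier := {q | ∀ x : tangentSpace U, IsDecomposable (x : ⋀[ℂ]^3 V) → q x = 0}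
  zero_mem' := fun _ _ => rfl
  add_mem' := fun {p q} hp hq x hx => by simp [hp x hx, hq x hx]
  smul_mem' := fun c q hq x hx => by simp [hq x hx]

/-- Pullback of quadratic forms along a linear map, as a linear map. -/
def quadPullback {W W' : Type*} [AddCommMonoid W] [Module ℂ W] [AddCommMonoid W'] [Module ℂ W']
    (f : W' →ₗ[ℂ] W) : QuadraticForm ℂ W →ₗ[ℂ] QuadraticForm ℂ W' where
  toFun q := q.comp f
  map_add' _ _ := rfl
  map_smul' _ _ := rfl

/-- The restriction map `r_K`, for `K = A ∩ T_U`, from the quadrics in `P(T_U)` containing the cone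
`C_U` to the quadrics in `P(K)`; the target `QuadraticForm ℂ K` is `Sym² K^∨`. -/
def restrictionMap (A : Submodule ℂ (⋀[ℂ]^3 V)) (U : Submodule ℂ V) :
    quadricsThroughCone U →ₗ[ℂ] QuadraticForm ℂ (interTangent A U) :=
  (quadPullback (Submodule.inclusion inf_le_right)).domRestrict (quadricsThroughCone U)

section SymmetricTensors

variable (K : Type*) [AddCommGroup K] [Module ℂ K]

/-- `Sym² K`, as the space of symmetric tensors in `K ⊗ K`. -/
def symTensors : Submodule ℂ (K ⊗[ℂ] K) :=
  LinearMap.eqLocus (TensorProduct.comm ℂ K K).toLinearMap LinearMap.id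

variable {K}

/-- The linear map `K^∨ → K` associated with a tensor `p ∈ K ⊗ K`, namely `f ↦ (f ⊗ id) p`. -/
def contraction (p : K ⊗[ℂ] K) : Module.Dual ℂ K →ₗ[ℂ] K where
  toFun f := TensorProduct.lid ℂ K (f.rTensor K p)
  map_add' f g := by rw [LinearMap.rTensor_add, LinearMap.add_apply, map_add]
  map_smul' c f := by rw [LinearMap.rTensor_smul, LinearMap.smul_apply, map_smul, RingHom.id_apply]

/-- The rank of a tensor `p ∈ K ⊗ K`: the rank of the associated linear map `K^∨ → K`. -/
def tensorRank (p : K ⊗[ℂ] K) : ℕ :=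
  Module.finrank ℂ (LinearMap.range (contraction p))

/-- The natural pairing of a quadratic form `q` on `K` with a tensor `p ∈ K ⊗ K`, as a linear
form in `q`: it sends `x ⊗ y` to `B_q(x, y)`, where `B_q` is the symmetric bilinear form with
`B_q(x, x) = q(x)`. Restricted to symmetric `p`, it is the duality between `Sym² K^∨` and
`Sym² K`. -/
def evalAtTensor (p : K ⊗[ℂ] K) : QuadraticForm ℂ K →ₗ[ℂ] ℂ :=
  LinearMap.applyₗ p ∘ₗ (TensorProduct.lift.equiv (RingHom.id ℂ) K K ℂ).toLinearMap ∘ₗ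
    QuadraticMap.associated

/-- The subspace of `Sym² K^∨` defined by the element `p` of `Sym² K` (a hyperplane when
`p ≠ 0`). -/
def hyperplaneOf (p : symTensors K) : Submodule ℂ (QuadraticForm ℂ K) :=
  LinearMap.ker (evalAtTensor (p : K ⊗[ℂ] K))

end SymmetricTensors

end EPWCube

end

/-!
A linear form `φ` on the quadratic forms on `K` is the same thing as the symmetric bilinear form
`(g, h) ↦ φ (g * h)` on `Kᵛ`, that is, as a symmetric tensor. Modulo `⋀³ U`, a vector of `T_U` is a
bilinear form on a product of two spaces of dimension three; it is decomposable exactly when this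
form has rank at most one, so that the quadrics through the cone are spanned by the nine `2 × 2`
minors.

Suppose that `φ ≠ 0` kills the restrictions to `K` of all the minors. If the bilinear form of `φ`
had rank at most three, some nonzero vector in its image, which is contained in `K`, would be
decomposable: this is an eigenvector argument when fixing some row or column of the matrix of linear
forms gives a surjective linear map, and a count of dimensions otherwise. As `K` contains no nonzero
decomposable vector, every nonzero `φ` in the annihilator of the image of `r_K` has rank at least
four. Hence there is none when `dim K ≤ 3`. When `dim K = 4`, the annihilator is a linear space
whose nonzero elements are invertible, so it is at most a line, since over an algebraically closed
field a pencil of endomorphisms contains a singular one. It is a line because there are only nine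
minors in the ten-dimensional space of quadratic forms on `K`.
-/

noncomputable section

namespace EPWCube

open Module LinearMap
open LinearMap (BilinForm)
open QuadraticMap (linMulLin)

section ProductForms

variable {𝕜 P Q : Type*} [Field 𝕜] [AddCommGroup P] [Module 𝕜 P] [AddCommGroup Q] [Module 𝕜 Q]

/-- A bilinear form that is a product `(a, b) ↦ α a * β b` of two linear forms, that is, a bilinear
form of rank at most one (the zero form is included). -/
def IsProductForm (F : P →ₗ[𝕜] Q →ₗ[𝕜] 𝕜) : Prop :=
  ∃ (α : Dual 𝕜 P) (β : Dual 𝕜 Q), ∀ a b, F a b = α a * β b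

variable {F : P →ₗ[𝕜] Q →ₗ[𝕜] 𝕜}

theorem IsProductForm.flip (hF : IsProductForm F) : IsProductForm F.flip := by
  obtain ⟨α, β, h⟩ := hF
  exact ⟨β, α, fun b a => by rw [flip_apply, h, mul_comm]⟩

theorem isProductForm_flip_iff : IsProductForm F.flip ↔ IsProductForm F :=
  ⟨fun h => h.flip, IsProductForm.flip⟩

theorem isProductForm_of_forall_mem_span_singleton {β : Dual 𝕜 Q} (h : ∀ a, F a ∈ 𝕜 ∙ β) :
    IsProductForm F := by
  obtain rfl | ⟨e, he⟩ : β = 0 ∨ ∃ e, β e ≠ 0 := by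
    by_contra! hβ
    exact hβ.1 (LinearMap.ext hβ.2)
  · refine ⟨0, 0, fun a b => ?_⟩
    have ha : F a = 0 := by simpa using h a
    simp [ha]
  · refine ⟨(β e)⁻¹ • F.flip e, β, fun a b => ?_⟩
    obtain ⟨μ, hμ⟩ := Submodule.mem_span_singleton.mp (h a)
    simp only [LinearMap.smul_apply, flip_apply, ← hμ, smul_eq_mul]
    field_simp

theorem isProductForm_of_finrank_le_finrank_ker_add_one [FiniteDimensional 𝕜 P]
    (h : finrank 𝕜 P ≤ finrank 𝕜 (ker F) + 1) : IsProductForm F := by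
  have hquot : finrank 𝕜 (P ⧸ ker F) ≤ 1 := by
    have := (ker F).finrank_quotient_add_finrank
    lia
  obtain ⟨v, hv⟩ := finrank_le_one_iff.mp hquot
  obtain ⟨e, rfl⟩ := (ker F).mkQ_surjective v
  refine isProductForm_of_forall_mem_span_singleton (β := F e) fun a => ?_
  obtain ⟨c, hc⟩ := hv ((ker F).mkQ a)
  rw [← map_smul, Submodule.mkQ_apply, Submodule.mkQ_apply, Submodule.Quotient.eq,
    sub_mem_comm_iff, sub_mem_ker_iff] at hc
  exact Submodule.mem_span_singleton.mpr ⟨c, by rw [hc, map_smul]⟩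

theorem isProductForm_of_basis {ι : Type*} (e : Basis ι 𝕜 P)
    (h : ∀ i j b d, F (e i) b * F (e j) d = F (e i) d * F (e j) b) : IsProductForm F := by
  obtain h₀ | ⟨i, hi⟩ : (∀ i, F (e i) = 0) ∨ ∃ i, F (e i) ≠ 0 := by
    by_contra! h'
    exact absurd (h'.2) (by simpa using h'.1)
  · exact ⟨0, 0, fun a b => by simp [show F = 0 from e.ext h₀]⟩
  obtain ⟨d, hd⟩ := DFunLike.ne_iff.mp hi
  have hspan : range F ≤ 𝕜 ∙ F (e i) := by
    rw [range_eq_map, ← e.span_eq, Submodule.map_span_le]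
    rintro _ ⟨j, rfl⟩
    refine Submodule.mem_span_singleton.mpr ⟨F (e j) d / F (e i) d, LinearMap.ext fun b => ?_⟩
    rw [LinearMap.smul_apply, smul_eq_mul, div_mul_eq_mul_div, div_eq_iff hd]
    linear_combination h i j b d
  exact isProductForm_of_forall_mem_span_singleton fun a => hspan (mem_range_self F a)

end ProductForms

theorem exists_common_eigenvector {𝕜 L ι : Type*} [Field 𝕜] [IsAlgClosed 𝕜] [AddCommGroup L]
    [Module 𝕜 L] [FiniteDimensional 𝕜 L] [Nontrivial L] (N : ι → End 𝕜 L)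
    (hN : ∀ i j, Commute (N i) (N j)) : ∃ t ≠ 0, ∀ i, ∃ μ : 𝕜, N i t = μ • t := by
  obtain ⟨W, ⟨hW₀, hW⟩, hmin⟩ := wellFounded_lt.has_min
    {W : Submodule 𝕜 L | W ≠ ⊥ ∧ ∀ i, ∀ w ∈ W, N i w ∈ W} ⟨⊤, top_ne_bot, fun _ _ _ => trivial⟩
  obtain ⟨t, htW, ht₀⟩ := W.ne_bot_iff.mp hW₀
  have : Nontrivial W := W.nontrivial_iff_ne_bot.mpr hW₀
  refine ⟨t, ht₀, fun i => ?_⟩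
  obtain ⟨μ, hμ⟩ := End.exists_eigenvalue ((N i).restrict (hW i))
  obtain ⟨w, hw⟩ := hμ.exists_hasEigenvector
  have hE : W ⊓ (N i).eigenspace μ = W := by
    refine le_antisymm inf_le_left
      (not_lt_iff_le_imp_ge.mp (hmin _ ⟨?_, fun j x hx => ?_⟩) inf_le_left)
    · exact (Submodule.ne_bot_iff _).mpr ⟨w, ⟨w.2, End.mem_eigenspace_iff.mpr
        (congrArg Subtype.val hw.apply_eq_smul)⟩, by simpa using hw.2⟩
    · exact ⟨hW j x hx.1, End.mapsTo_genEigenspace_of_comm (hN i j) μ 1 hx.2⟩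
  exact ⟨μ, End.mem_eigenspace_iff.mp (hE.ge htW).2⟩

section Apolar

variable {𝕜 L P Q : Type*} [Field 𝕜] [AddCommGroup L] [Module 𝕜 L] [AddCommGroup P] [Module 𝕜 P]
  [AddCommGroup Q] [Module 𝕜 Q]

/-- A bilinear form `B` on `L` is apolar to a bilinear map `f` with values in `L` if, seen as a
linear form on products of elements of `L`, it kills the `2 × 2` minors
`f a b * f c d - f a d * f c b`. -/
def IsApolar (B : BilinForm 𝕜 L) (f : P →ₗ[𝕜] Q →ₗ[𝕜] L) : Prop :=
  ∀ a b c d, B (f a b) (f c d) = B (f a d) (f c b)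

variable {B : BilinForm 𝕜 L} {f : P →ₗ[𝕜] Q →ₗ[𝕜] L}

theorem IsApolar.flip (hf : IsApolar B f) (hB : B.IsSymm) : IsApolar B f.flip :=
  fun b a d c => by simpa [hB.eq] using hf a b c d |>.trans (hB.eq _ _).symm

theorem IsApolar.isProductForm_of_forall_mem_span (hf : IsApolar B f) {a₀ : P} {e : Q}
    (h : ∀ b, f a₀ b ∈ 𝕜 ∙ f a₀ e) : IsProductForm (f.compr₂ (B (f a₀ e))) := by
  rw [← isProductForm_flip_iff]
  refine isProductForm_of_forall_mem_span_singleton (β := B (f a₀ e) ∘ₗ f.flip e) fun b => ?_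
  obtain ⟨μ, hμ⟩ := Submodule.mem_span_singleton.mp (h b)
  refine Submodule.mem_span_singleton.mpr ⟨μ, LinearMap.ext fun c => ?_⟩
  simp [hf a₀ e c b, ← hμ]

variable [FiniteDimensional 𝕜 L]

theorem IsApolar.exists_isProductForm_of_surjective [IsAlgClosed 𝕜] [Nontrivial L]
    (hf : IsApolar B f) (hB : B.IsSymm) (hnd : B.Nondegenerate) {a₀ : P}
    (hs : Function.Surjective (f a₀)) : ∃ t ≠ 0, IsProductForm (f.compr₂ (B t)) := by
  have ext_of_B {y z : L} (h : ∀ b, B (f a₀ b) y = B (f a₀ b) z) : y = z :=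
    sub_eq_zero.mp <| hnd.2 _ fun x => by
      obtain ⟨b, rfl⟩ := hs x
      rw [map_sub, h, sub_self]
  obtain ⟨s, hs'⟩ := (f a₀).exists_rightInverse_of_surjective (range_eq_top.mpr hs)
  replace hs' x : f a₀ (s x) = x := LinearMap.congr_fun hs' x
  -- By apolarity, the endomorphisms `f c ∘ (f a₀)⁻¹` are well defined, commute with each other and
  -- are self-adjoint for `B`, so that they have a common eigenvector `t`.
  let N (c : P) : End 𝕜 L := f c ∘ₗ s
  have hN c b : N c (f a₀ b) = f c b := ext_of_B fun d => by
    simp only [N, LinearMap.comp_apply, hf a₀ d c, hs']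
  have hadj c x y : B (N c x) y = B x (N c y) := by
    obtain ⟨b, rfl⟩ := hs x
    obtain ⟨d, rfl⟩ := hs y
    rw [hN, hN, hf c b, hB.eq]
  have hcomm c c' : Commute (N c) (N c') := LinearMap.ext fun y => ext_of_B fun b => by
    obtain ⟨d, rfl⟩ := hs y
    rw [End.mul_apply, End.mul_apply, ← hadj c, ← hadj c' (f a₀ b), hN, hN, hN, hN, hf c b, hB.eq]
  obtain ⟨t, ht₀, ht⟩ := exists_common_eigenvector N hcomm
  refine ⟨t, ht₀, isProductForm_of_forall_mem_span_singleton (β := B t ∘ₗ f a₀) fun c => ?_⟩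
  obtain ⟨μ, hμ⟩ := ht c
  refine Submodule.mem_span_singleton.mpr ⟨μ, LinearMap.ext fun b => ?_⟩
  rw [compr₂_apply, ← hN, ← hadj, hμ]
  simp

theorem exists_ne_zero_forall_apply_eq_zero (hB : B.IsSymm) (hnd : B.Nondegenerate)
    {W : Submodule 𝕜 L} (hW : W ≠ ⊤) : ∃ t ≠ 0, ∀ w ∈ W, B t w = 0 := by
  have hpos : 0 < finrank 𝕜 (B.orthogonal W) := by
    rw [BilinForm.finrank_orthogonal hnd]
    have := Submodule.finrank_lt hW
    lia
  obtain ⟨t, ht, ht₀⟩ := (Submodule.ne_bot_iff _).mp (Submodule.one_le_finrank_iff.mp hpos)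
  exact ⟨t, ht₀, fun w hw => (hB.eq _ _).symm.trans (ht w hw)⟩

theorem exists_isProductForm_of_apply_eq_zero [FiniteDimensional 𝕜 P] (hB : B.IsSymm)
    (hnd : B.Nondegenerate) (hP : finrank 𝕜 P ≤ 3) {a₀ a₁ : P} (ha₀ : a₀ ≠ 0) (hf₀ : f a₀ = 0)
    (hf₁ : f a₁ ≠ 0) (hs : ¬ Function.Surjective (f a₁)) :
    ∃ t ≠ 0, IsProductForm (f.compr₂ (B t)) := by
  obtain ⟨t, ht₀, ht⟩ := exists_ne_zero_forall_apply_eq_zero hB hnd (mt range_eq_top.mp hs)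
  refine ⟨t, ht₀, isProductForm_of_finrank_le_finrank_ker_add_one ?_⟩
  have hind : LinearIndependent 𝕜 ![a₀, a₁] :=
    (LinearIndependent.pair_iff' ha₀).mpr fun c hc => hf₁ (by simp [← hc, hf₀])
  have hker : Submodule.span 𝕜 (Set.range ![a₀, a₁]) ≤ ker (f.compr₂ (B t)) := by
    simp only [Matrix.range_cons, Matrix.range_empty, Set.union_empty, Submodule.span_le,
      Set.union_subset_iff, Set.singleton_subset_iff, SetLike.mem_coe, mem_ker]
    exact ⟨LinearMap.ext fun b => by simp [hf₀], LinearMap.ext fun b => ht _ (mem_range_self _ b)⟩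
  have := Submodule.finrank_mono hker
  rw [finrank_span_eq_card hind, Fintype.card_fin] at this
  lia

theorem mem_span_singleton_of_finrank_le_one {W : Submodule 𝕜 L} (hW : finrank 𝕜 W ≤ 1) {x y : L}
    (hx : x ∈ W) (hx₀ : x ≠ 0) (hy : y ∈ W) : y ∈ 𝕜 ∙ x := by
  rwa [Submodule.eq_of_le_of_finrank_le ((Submodule.span_singleton_le_iff_mem x W).mpr hx)
    (by rwa [finrank_span_singleton hx₀])]

theorem IsApolar.exists_isProductForm_of_not_surjective [FiniteDimensional 𝕜 P]
    (hf : IsApolar B f) (hB : B.IsSymm) (hnd : B.Nondegenerate)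
    (hLP : finrank 𝕜 L ≤ finrank 𝕜 P) (hP : finrank 𝕜 P ≤ 3) {a : P} {b : Q} (hab : f a b ≠ 0)
    (hs : ¬ Function.Surjective (f a)) (hs' : ¬ Function.Surjective (f.flip b)) :
    ∃ t ≠ 0, IsProductForm (f.compr₂ (B t)) := by
  let W : Submodule 𝕜 L := range (f.flip b)
  have hW : finrank 𝕜 W < finrank 𝕜 L := Submodule.finrank_lt (mt range_eq_top.mp hs')
  obtain ⟨a₀, hker, ha₀⟩ : ∃ a₀ ∈ ker (f.flip b), a₀ ≠ 0 := by
    refine (Submodule.ne_bot_iff _).mp fun hbot => ?_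
    have : finrank 𝕜 W = finrank 𝕜 P := finrank_range_of_inj (ker_eq_bot.mp hbot)
    lia
  have horth d : f a₀ d ∈ B.orthogonal W := by
    rintro _ ⟨c, rfl⟩
    have : f a₀ b = 0 := hker
    simp [hf c b a₀ d, this]
  -- As `dim L ≤ 3`, either `W` or its orthogonal is at most a line.
  by_cases hW₁ : finrank 𝕜 W ≤ 1
  · exact ⟨f a b, hab, ((hf.flip hB).isProductForm_of_forall_mem_span fun c =>
      mem_span_singleton_of_finrank_le_one hW₁ (mem_range_self _ a) hab (mem_range_self _ c)).flip⟩
  obtain h₀ | ⟨e, he⟩ : f a₀ = 0 ∨ ∃ e, f a₀ e ≠ 0 := by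
    by_contra! h
    exact h.1 (LinearMap.ext h.2)
  · exact exists_isProductForm_of_apply_eq_zero hB hnd hP ha₀ h₀ (fun h => hab (by simp [h])) hs
  · have horth₁ : finrank 𝕜 (B.orthogonal W) ≤ 1 := by
      rw [BilinForm.finrank_orthogonal hnd]
      lia
    exact ⟨f a₀ e, he, hf.isProductForm_of_forall_mem_span fun b =>
      mem_span_singleton_of_finrank_le_one horth₁ (horth e) he (horth b)⟩

theorem IsApolar.exists_isProductForm_of_nondegenerate [IsAlgClosed 𝕜] [Nontrivial L]
    [FiniteDimensional 𝕜 P] (hf : IsApolar B f) (hB : B.IsSymm) (hnd : B.Nondegenerate)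
    (hLP : finrank 𝕜 L ≤ finrank 𝕜 P) (hP : finrank 𝕜 P ≤ 3) :
    ∃ t ≠ 0, IsProductForm (f.compr₂ (B t)) := by
  obtain h₀ | ⟨a, b, hab⟩ : (∀ a b, f a b = 0) ∨ ∃ a b, f a b ≠ 0 := by
    by_contra! h
    exact h.1.elim fun a ⟨b, hab⟩ => hab (h.2 a b)
  · obtain ⟨t, ht₀⟩ := exists_ne (0 : L)
    exact ⟨t, ht₀, 0, 0, fun a b => by simp [h₀]⟩
  by_cases hs : Function.Surjective (f a)
  · exact hf.exists_isProductForm_of_surjective hB hnd hs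
  by_cases hs' : Function.Surjective (f.flip b)
  · obtain ⟨t, ht₀, ht⟩ := (hf.flip hB).exists_isProductForm_of_surjective hB hnd hs'
    exact ⟨t, ht₀, ht.flip⟩
  · exact hf.exists_isProductForm_of_not_surjective hB hnd hLP hP hab hs hs'

theorem IsApolar.exists_isProductForm [IsAlgClosed 𝕜] [FiniteDimensional 𝕜 P] (hf : IsApolar B f)
    (hB : B.IsSymm) (hB₀ : B ≠ 0) (hrank : finrank 𝕜 (range B) ≤ finrank 𝕜 P)
    (hP : finrank 𝕜 P ≤ 3) : ∃ t, B t ≠ 0 ∧ IsProductForm (f.compr₂ (B t)) := by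
  obtain ⟨W, hW⟩ := (ker B).exists_isCompl
  let π : L →ₗ[𝕜] W := W.projectionOnto (ker B) hW.symm
  have hπ x : B (π x) = B x := by
    rw [← sub_eq_zero, ← map_sub, ← mem_ker]
    refine (Submodule.projectionOnto_apply_eq_zero_iff hW.symm).mp ?_
    rw [map_sub, Submodule.projectionOnto_apply_left, sub_self]
  let B' : BilinForm 𝕜 W := B.domRestrict₁₂ W W
  have hB' x y : B' (π x) (π y) = B x y := by
    rw [domRestrict₁₂_apply, hπ, hB.eq, hπ, hB.eq]
  have hnd : B'.Nondegenerate := LinearMap.IsSymm.nondegenerate_restrict_of_isCompl_ker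
    ⟨hB.eq⟩ hW.symm
  have hWr : finrank 𝕜 W = finrank 𝕜 (range B) := by
    have := finrank_range_add_finrank_ker B
    have := Submodule.finrank_add_eq_of_isCompl hW
    lia
  have : Nontrivial W := by
    rw [← finrank_pos_iff (R := 𝕜), hWr]
    exact Submodule.one_le_finrank_iff.mpr (mt range_eq_bot.mp hB₀)
  have hf' : IsApolar B' (f.compr₂ π) := fun a b c d => by
    simp only [compr₂_apply, hB', hf a b c d]
  obtain ⟨t, ht₀, α, β, ht⟩ := hf'.exists_isProductForm_of_nondegenerate ⟨fun x y => hB.eq x y⟩ hnd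
    (hWr.trans_le hrank) hP
  refine ⟨t, fun h => ht₀ (hnd.1 t fun y => LinearMap.congr_fun h y), α, β, fun a b => ?_⟩
  rw [← ht, compr₂_apply, compr₂_apply, compr₂_apply, domRestrict₁₂_apply, hB.eq, ← hπ, hB.eq]

end Apolar

theorem finrank_le_one_of_forall_injective {𝕜 X Y : Type*} [Field 𝕜] [IsAlgClosed 𝕜]
    [AddCommGroup X] [Module 𝕜 X] [FiniteDimensional 𝕜 X] [Nontrivial X] [AddCommGroup Y]
    [Module 𝕜 Y] [FiniteDimensional 𝕜 Y] (hXY : finrank 𝕜 X = finrank 𝕜 Y)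
    (W : Submodule 𝕜 (X →ₗ[𝕜] Y)) (hW : ∀ w ∈ W, w ≠ 0 → Function.Injective w) :
    finrank 𝕜 W ≤ 1 := by
  by_cases hbot : W = ⊥
  · rw [hbot, finrank_bot]
    exact zero_le_one
  obtain ⟨w₁, hw₁, hne⟩ := W.ne_bot_iff.mp hbot
  let e : X ≃ₗ[𝕜] Y := w₁.linearEquivOfInjective (hW w₁ hw₁ hne) hXY
  refine finrank_le_one ⟨w₁, hw₁⟩ fun ⟨w, hw⟩ => ?_
  -- For an eigenvalue `μ` of `w₁⁻¹ ∘ w`, the map `w - μ • w₁` is not injective, hence vanishes.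
  obtain ⟨μ, hμ⟩ := End.exists_eigenvalue (e.symm.toLinearMap ∘ₗ w)
  obtain ⟨x, hx⟩ := hμ.exists_hasEigenvector
  have hwx : (w - μ • w₁) x = 0 := by
    have : e.symm (w x) = μ • x := hx.apply_eq_smul
    rw [LinearEquiv.symm_apply_eq, map_smul, linearEquivOfInjective_apply] at this
    simp [this]
  by_contra hμ₀
  have hinj := hW _ (W.sub_mem hw (W.smul_mem μ hw₁))
    fun h => hμ₀ ⟨μ, Subtype.ext (sub_eq_zero.mp h).symm⟩
  exact hx.2 (hinj (hwx.trans (map_zero _).symm))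

section QuadraticForms

variable {𝕜 K : Type*} [Field 𝕜] [AddCommGroup K] [Module 𝕜 K]

variable (𝕜 K) in
/-- Multiplication of linear forms as a bilinear map with values in quadratic forms. -/
def mulForms : Dual 𝕜 K →ₗ[𝕜] Dual 𝕜 K →ₗ[𝕜] QuadraticForm 𝕜 K :=
  mk₂ 𝕜 linMulLin QuadraticMap.add_linMulLin (fun c g h => by ext; simp [mul_assoc])
    QuadraticMap.linMulLin_add (fun c g h => by ext; simp [mul_left_comm])

/-- The symmetric bilinear form `(g, h) ↦ φ (g * h)` on `Kᵛ` attached to a linear form `φ` on the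
quadratic forms on `K`; it encodes `φ` as an element of `Sym² K`. -/
def dualForm : Dual 𝕜 (QuadraticForm 𝕜 K) →ₗ[𝕜] BilinForm 𝕜 (Dual 𝕜 K) where
  toFun φ := (mulForms 𝕜 K).compr₂ φ
  map_add' _ _ := rfl
  map_smul' _ _ := rfl

@[simp]
theorem dualForm_apply (φ : Dual 𝕜 (QuadraticForm 𝕜 K)) (g h : Dual 𝕜 K) :
    dualForm φ g h = φ (linMulLin g h) := rfl

theorem isSymm_dualForm (φ : Dual 𝕜 (QuadraticForm 𝕜 K)) : (dualForm φ).IsSymm :=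
  ⟨fun g h => congrArg φ (QuadraticMap.ext fun x => mul_comm (g x) (h x))⟩

/-- The coordinates of a quadratic form on a family of vectors `b`, given by its polar form; the
diagonal ones are thus twice the values of the quadratic form. -/
def polarCoordinates {ι : Type*} (b : ι → K) : QuadraticForm 𝕜 K →ₗ[𝕜] (Sym2 ι → 𝕜) where
  toFun q := Sym2.lift
    ⟨fun i j => QuadraticMap.polar q (b i) (b j), fun i j => QuadraticMap.polar_comm q _ _⟩
  map_add' q q' := funext <| Sym2.ind fun i j => by simp [QuadraticMap.polar_add]
  map_smul' c q := funext <| Sym2.ind fun i j => by simp [QuadraticMap.polar_smul]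

theorem polarCoordinates_apply {ι : Type*} (b : ι → K) (q : QuadraticForm 𝕜 K) (i j : ι) :
    polarCoordinates b q s(i, j) = QuadraticMap.polar q (b i) (b j) := rfl

variable [NeZero (2 : 𝕜)]

theorem bijective_polarCoordinates {ι : Type*} [Finite ι] (b : Basis ι 𝕜 K) :
    Function.Bijective (polarCoordinates (𝕜 := 𝕜) b) := by
  refine ⟨(injective_iff_map_eq_zero _).mpr fun q hq => ?_, fun c => ?_⟩
  · refine QuadraticMap.polarBilin_injective (IsUnit.mk0 2 two_ne_zero)
      (ext_basis b b fun i j => ?_)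
    exact (congrFun hq s(i, j)).trans (by simp [QuadraticMap.polar])
  · classical
    have := Fintype.ofFinite ι
    let B : BilinForm 𝕜 K := Matrix.toBilin b (Matrix.of fun i j => c s(i, j) / 2)
    have hB i j : B (b i) (b j) = c s(i, j) / 2 := by
      simp [B, Matrix.toBilin_apply, Finsupp.single_apply]
    refine ⟨B.toQuadraticMap, funext <| Sym2.ind fun i j => ?_⟩
    rw [polarCoordinates_apply, BilinMap.polar_toQuadraticMap, hB, hB, Sym2.eq_swap, add_halves]

variable [FiniteDimensional 𝕜 K]

instance finiteDimensional_quadraticForm : FiniteDimensional 𝕜 (QuadraticForm 𝕜 K) :=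
  .of_injective _ (bijective_polarCoordinates (finBasis 𝕜 K)).1

theorem finrank_quadraticForm :
    finrank 𝕜 (QuadraticForm 𝕜 K) = (finrank 𝕜 K + 1).choose 2 := by
  rw [(LinearEquiv.ofBijective _ (bijective_polarCoordinates (finBasis 𝕜 K))).finrank_eq,
    finrank_fintype_fun_eq_card, Sym2.card, Fintype.card_fin]

theorem span_range_linMulLin :
    Submodule.span 𝕜 (Set.range fun p : Dual 𝕜 K × Dual 𝕜 K => linMulLin p.1 p.2) = ⊤ := by
  refine eq_top_iff.mpr fun q _ => ?_
  let b := finBasis 𝕜 K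
  have : Invertible (2 : 𝕜) := invertibleOfNonzero two_ne_zero
  let B := QuadraticMap.associated (R := 𝕜) q
  have hq : q = ∑ i, ∑ j, B (b i) (b j) • linMulLin (b.coord i) (b.coord j) := by
    ext x
    rw [← QuadraticMap.associated_eq_self_apply 𝕜 q x]
    refine (sum_repr_mul_repr_mul b b x x).symm.trans ?_
    simp [B, Finsupp.sum_fintype, mul_assoc, mul_comm]
  rw [hq]
  exact Submodule.sum_mem _ fun i _ => Submodule.sum_mem _ fun j _ => Submodule.smul_mem _ _ <|
    Submodule.subset_span ⟨(b.coord i, b.coord j), rfl⟩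

theorem dualForm_injective : Function.Injective (dualForm : _ →ₗ[𝕜] BilinForm 𝕜 (Dual 𝕜 K)) := by
  refine fun φ ψ h => ext_on_range span_range_linMulLin ?_
  exact fun p => LinearMap.congr_fun₂ h p.1 p.2

end QuadraticForms

section Tensors

variable {K : Type*} [AddCommGroup K] [Module ℂ K]

theorem dual_contraction (p : K ⊗[ℂ] K) (g h : Dual ℂ K) :
    h (contraction p g) = TensorProduct.dualDistrib ℂ K K (g ⊗ₜ h) p := by
  change (h ∘ₗ (TensorProduct.lid ℂ K).toLinearMap ∘ₗ g.rTensor K) p = _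
  congr 1
  ext x y
  simp

theorem evalAtTensor_linMulLin (p : symTensors K) (g h : Dual ℂ K) :
    evalAtTensor (p : K ⊗[ℂ] K) (linMulLin g h) = h (contraction (p : K ⊗[ℂ] K) g) := by
  have hsymm : TensorProduct.dualDistrib ℂ K K (h ⊗ₜ g) p =
      TensorProduct.dualDistrib ℂ K K (g ⊗ₜ h) p := by
    have hp : TensorProduct.comm ℂ K K p = p := p.2
    nth_rewrite 1 [← hp]
    change (TensorProduct.dualDistrib ℂ K K (h ⊗ₜ g) ∘ₗ
      (TensorProduct.comm ℂ K K).toLinearMap) _ = _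
    congr 1
    ext x y
    simp [mul_comm]
  have hassoc : TensorProduct.lift (QuadraticMap.associated (linMulLin g h)) =
      (2⁻¹ : ℂ) • (TensorProduct.dualDistrib ℂ K K (g ⊗ₜ h) +
        TensorProduct.dualDistrib ℂ K K (h ⊗ₜ g)) := by
    ext x y
    simp [QuadraticMap.associated_linMulLin]
  change TensorProduct.lift (QuadraticMap.associated (linMulLin g h)) (p : K ⊗[ℂ] K) = _
  rw [hassoc, LinearMap.smul_apply, LinearMap.add_apply, hsymm, dual_contraction, smul_eq_mul]
  ring

variable [FiniteDimensional ℂ K]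

theorem tensorRank_eq_finrank_range {p : K ⊗[ℂ] K} {B : BilinForm ℂ (Dual ℂ K)}
    (hB : ∀ g h, h (contraction p g) = B g h) : tensorRank p = finrank ℂ (range B) := by
  have : B = (evalEquiv ℂ K).toLinearMap ∘ₗ contraction p := by
    ext g h
    exact (hB g h).symm
  rw [this, range_comp, LinearEquiv.finrank_map_eq]
  rfl

theorem exists_symTensor_contraction_eq {B : BilinForm ℂ (Dual ℂ K)} (hB : B.IsSymm) :
    ∃ p : symTensors K, ∀ g h, h (contraction (p : K ⊗[ℂ] K) g) = B g h := by
  let b := finBasis ℂ K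
  let p : K ⊗[ℂ] K := ∑ i, ∑ j, B (b.coord i) (b.coord j) • b i ⊗ₜ b j
  have hp : TensorProduct.comm ℂ K K p = p := by
    simp only [p, map_sum, map_smul, TensorProduct.comm_tmul]
    rw [Finset.sum_comm]
    exact Finset.sum_congr rfl fun i _ => Finset.sum_congr rfl fun j _ => by rw [hB.eq]
  refine ⟨⟨p, hp⟩, fun g h => ?_⟩
  rw [dual_contraction, ← sum_repr_mul_repr_mul b.dualBasis b.dualBasis g h]
  simp [p, Finsupp.sum_fintype, mul_comm, mul_assoc]

theorem exists_symTensor_evalAtTensor_eq (φ : Dual ℂ (QuadraticForm ℂ K)) :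
    ∃ p : symTensors K, evalAtTensor (p : K ⊗[ℂ] K) = φ ∧
      tensorRank (p : K ⊗[ℂ] K) = finrank ℂ (range (dualForm φ)) := by
  obtain ⟨p, hp⟩ := exists_symTensor_contraction_eq (isSymm_dualForm φ)
  refine ⟨p, dualForm_injective (LinearMap.ext₂ fun g h => ?_), tensorRank_eq_finrank_range hp⟩
  rw [dualForm_apply, evalAtTensor_linMulLin, hp]

end Tensors

section ProductCone

variable {𝕜 S P Q : Type*} [Field 𝕜] [AddCommGroup S] [Module 𝕜 S] [AddCommGroup P] [Module 𝕜 P]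
  [AddCommGroup Q] [Module 𝕜 Q]

/-- For a family `f` of linear forms on `S` indexed bilinearly by `P × Q`, so that every vector of
`S` gives a bilinear form on `P × Q`, the cone of vectors giving a form of rank at most one. -/
def productCone (f : P →ₗ[𝕜] Q →ₗ[𝕜] Dual 𝕜 S) : Set S :=
  {x | IsProductForm (f.compr₂ (Dual.eval 𝕜 S x))}

/-- The quadratic form on `S` which is the `2 × 2` minor of the bilinear form given by `f`, on the
rows `a, c` and the columns `b, d`. -/
def minor (f : P →ₗ[𝕜] Q →ₗ[𝕜] Dual 𝕜 S) (a : P) (b : Q) (c : P) (d : Q) : QuadraticForm 𝕜 S :=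
  linMulLin (f a b) (f c d) - linMulLin (f a d) (f c b)

/-- The quadratic forms on `S` that vanish on `productCone f`. -/
def quadricsThroughProductCone (f : P →ₗ[𝕜] Q →ₗ[𝕜] Dual 𝕜 S) :
    Submodule 𝕜 (QuadraticForm 𝕜 S) where
  carrier := {q | ∀ x ∈ productCone f, q x = 0}
  zero_mem' _ _ := rfl
  add_mem' hp hq x hx := by simp [hp x hx, hq x hx]
  smul_mem' c q hq x hx := by simp [hq x hx]

variable {f : P →ₗ[𝕜] Q →ₗ[𝕜] Dual 𝕜 S}

theorem mem_productCone {x : S} :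
    x ∈ productCone f ↔ ∃ (α : Dual 𝕜 P) (β : Dual 𝕜 Q), ∀ a b, f a b x = α a * β b := Iff.rfl

theorem minor_apply (a : P) (b : Q) (c : P) (d : Q) (x : S) :
    minor f a b c d x = f a b x * f c d x - f a d x * f c b x := rfl

theorem minor_mem_quadricsThroughProductCone (a : P) (b : Q) (c : P) (d : Q) :
    minor f a b c d ∈ quadricsThroughProductCone f := by
  rintro x ⟨α, β, h⟩
  replace h : ∀ a b, f a b x = α a * β b := h
  rw [minor_apply, h, h, h, h]
  ring

theorem isApolar_dualForm {φ : Dual 𝕜 (QuadraticForm 𝕜 S)}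
    (hφ : ∀ a b c d, φ (minor f a b c d) = 0) : IsApolar (dualForm φ) f := fun a b c d => by
  rw [dualForm_apply, dualForm_apply, ← sub_eq_zero, ← map_sub]
  exact hφ a b c d

theorem polar_minor (a : P) (b : Q) (c : P) (d : Q) (x y : S) :
    QuadraticMap.polar (minor f a b c d) x y =
      f a b x * f c d y + f a b y * f c d x - f a d x * f c b y - f a d y * f c b x := by
  simp only [QuadraticMap.polar, minor_apply, map_add]
  ring

theorem polar_eq_zero_of_mem_productCone {q : QuadraticForm 𝕜 S}
    (hq : q ∈ quadricsThroughProductCone f) {x y : S} (hx : x ∈ productCone f)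
    (hy : y ∈ productCone f) (hxy : x + y ∈ productCone f) : QuadraticMap.polar q x y = 0 := by
  rw [QuadraticMap.polar, hq _ hx, hq _ hy, hq _ hxy, sub_zero, sub_zero]

section Dimension

variable {ι κ : Type*} {e : Basis ι 𝕜 P} {c : Basis κ 𝕜 Q} {r : ι → κ → S}
  {q : QuadraticForm 𝕜 S}

theorem polar_swap_of_mem_quadricsThroughProductCone (hq : q ∈ quadricsThroughProductCone f)
    (hr : ∀ i j a b, f a b (r i j) = e.coord i a * c.coord j b) (i k : ι) (j l : κ) :
    QuadraticMap.polar q (r i j) (r k l) = -QuadraticMap.polar q (r i l) (r k j) := by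
  have mem_of_eq {x : S} (α : Dual 𝕜 P) (β : Dual 𝕜 Q) (h : ∀ a b, f a b x = α a * β b) :
      x ∈ productCone f := ⟨α, β, h⟩
  have mem i j : r i j ∈ productCone f := mem_of_eq _ _ (hr i j)
  have mem_row i : r i j + r i l ∈ productCone f :=
    mem_of_eq (e.coord i) (c.coord j + c.coord l) fun a b => by
      rw [map_add, hr, hr, LinearMap.add_apply, mul_add]
  have mem_col j : r i j + r k j ∈ productCone f :=
    mem_of_eq (e.coord i + e.coord k) (c.coord j) fun a b => by
      rw [map_add, hr, hr, LinearMap.add_apply, add_mul]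
  have mem_all : r i j + r i l + (r k j + r k l) ∈ productCone f :=
    mem_of_eq (e.coord i + e.coord k) (c.coord j + c.coord l) fun a b => by
      simp only [map_add, hr, LinearMap.add_apply]
      ring
  have hsum := polar_eq_zero_of_mem_productCone hq (mem_row i) (mem_row k) mem_all
  rw [QuadraticMap.polar_add_left, QuadraticMap.polar_add_right, QuadraticMap.polar_add_right,
    polar_eq_zero_of_mem_productCone hq (mem i j) (mem k j) (mem_col j),
    polar_eq_zero_of_mem_productCone hq (mem i l) (mem k l) (mem_col l)] at hsum
  linear_combination hsum

theorem span_union_range_eq_top [Finite ι] [Finite κ]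
    (hr : ∀ i j a b, f a b (r i j) = e.coord i a * c.coord j b) :
    Submodule.span 𝕜 ({x | ∀ a b, f a b x = 0} ∪ Set.range fun p : ι × κ => r p.1 p.2) = ⊤ := by
  have := Fintype.ofFinite ι
  have := Fintype.ofFinite κ
  refine eq_top_iff.mpr fun x _ => ?_
  let y : S := ∑ i, ∑ j, f (e i) (c j) x • r i j
  have hxy : f.compr₂ (Dual.eval 𝕜 S (x - y)) = 0 := ext_basis e c fun i j => by
    classical simp [y, hr, Finsupp.single_apply]
  rw [← sub_add_cancel x y]
  refine Submodule.add_mem _ (Submodule.subset_span (.inl (LinearMap.congr_fun₂ hxy))) ?_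
  exact Submodule.sum_mem _ fun i _ => Submodule.sum_mem _ fun j _ => Submodule.smul_mem _ _ <|
    Submodule.subset_span (.inr ⟨(i, j), rfl⟩)

theorem eq_zero_of_forall_polar_eq_zero [NeZero (2 : 𝕜)] [Finite ι] [Finite κ]
    (hq : q ∈ quadricsThroughProductCone f)
    (hr : ∀ i j a b, f a b (r i j) = e.coord i a * c.coord j b)
    (h : ∀ i j k l, QuadraticMap.polar q (r i j) (r k l) = 0) : q = 0 := by
  have hspan := span_union_range_eq_top hr
  have polar_of_mem {z x : S} (hz : ∀ a b, f a b z = 0) (hx : x ∈ productCone f) :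
      QuadraticMap.polar q z x = 0 := by
    refine polar_eq_zero_of_mem_productCone hq ⟨0, 0, fun a b => by simp [hz]⟩ hx ?_
    obtain ⟨α, β, hx⟩ := hx
    exact ⟨α, β, fun a b => by simpa [hz] using hx a b⟩
  have polar_of_forall {z x : S} (hz : ∀ a b, f a b z = 0) : QuadraticMap.polar q z x = 0 := by
    suffices QuadraticMap.polarBilin q z = 0 from LinearMap.congr_fun this x
    refine ext_on hspan ?_
    rintro x (hx | ⟨⟨i, j⟩, rfl⟩)
    · exact polar_of_mem hz ⟨0, 0, fun a b => by simp [hx a b]⟩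
    · exact polar_of_mem hz ⟨_, _, hr i j⟩
  refine QuadraticMap.polarBilin_injective (IsUnit.mk0 2 two_ne_zero) ?_
  refine ext_on hspan fun x hx => ext_on hspan fun y hy => ?_
  refine Eq.trans (b := 0) ?_ (by simp [QuadraticMap.polar])
  rw [QuadraticMap.polarBilin_apply_apply]
  obtain hx | ⟨⟨i, j⟩, rfl⟩ := hx
  · exact polar_of_forall hx
  obtain hy | ⟨⟨k, l⟩, rfl⟩ := hy
  · rw [QuadraticMap.polar_comm]
    exact polar_of_forall hy
  · exact h i j k l

variable [LinearOrder ι] [LinearOrder κ]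

/-- The coordinates, with respect to the minors on a family of vectors `r i j`, of a quadratic form
on `S`; pairs of indices are encoded as order embeddings of `Fin 2`. -/
def minorCoordinates (r : ι → κ → S) :
    QuadraticForm 𝕜 S →ₗ[𝕜] ((Fin 2 ↪o ι) × (Fin 2 ↪o κ) → 𝕜) where
  toFun q p := QuadraticMap.polar q (r (p.1 0) (p.2 0)) (r (p.1 1) (p.2 1))
  map_add' q q' := funext fun p => by simp [QuadraticMap.polar_add]
  map_smul' a q := funext fun p => by simp [QuadraticMap.polar_smul]

theorem minorCoordinates_apply (q : QuadraticForm 𝕜 S) (p : (Fin 2 ↪o ι) × (Fin 2 ↪o κ)) :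
    minorCoordinates r q p = QuadraticMap.polar q (r (p.1 0) (p.2 0)) (r (p.1 1) (p.2 1)) := rfl

theorem minorCoordinates_minor (hr : ∀ i j a b, f a b (r i j) = e.coord i a * c.coord j b)
    (p : (Fin 2 ↪o ι) × (Fin 2 ↪o κ)) :
    minorCoordinates r (minor f (e (p.1 0)) (c (p.2 0)) (e (p.1 1)) (c (p.2 1))) =
      Pi.single p 1 := by
  ext p'
  have := p.1.strictMono (zero_lt_one' (Fin 2))
  have := p.2.strictMono (zero_lt_one' (Fin 2))
  have := p'.1.strictMono (zero_lt_one' (Fin 2))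
  have := p'.2.strictMono (zero_lt_one' (Fin 2))
  have hp : p' = p ↔ (p'.1 0 = p.1 0 ∧ p'.1 1 = p.1 1) ∧ p'.2 0 = p.2 0 ∧ p'.2 1 = p.2 1 := by
    simp only [Prod.ext_iff, RelEmbedding.ext_iff, Fin.forall_fin_two]
  simp only [minorCoordinates_apply, polar_minor, hr, Basis.coord_apply, Basis.repr_self,
    Finsupp.single_apply, Pi.single_apply, hp]
  grind

theorem injective_minorCoordinates_domRestrict [NeZero (2 : 𝕜)] [Finite ι] [Finite κ]
    (hr : ∀ i j a b, f a b (r i j) = e.coord i a * c.coord j b) :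
    Function.Injective ((minorCoordinates r).domRestrict (quadricsThroughProductCone f)) := by
  refine (injective_iff_map_eq_zero _).mpr fun ⟨q, hq⟩ h => Subtype.ext ?_
  have swap := polar_swap_of_mem_quadricsThroughProductCone hq hr
  have eq_zero_of_eq_neg {x : 𝕜} (hx : x = -x) : x = 0 :=
    (mul_eq_zero.mp (by linear_combination hx : 2 * x = 0)).resolve_left two_ne_zero
  have polar_of_lt {i k : ι} {j l : κ} (hik : i < k) (hjl : j < l) :
      QuadraticMap.polar q (r i j) (r k l) = 0 :=
    congrFun h (.ofStrictMono ![i, k] (by simpa using hik),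
      .ofStrictMono ![j, l] (by simpa using hjl))
  have polar_of_lt_left {i k : ι} (hik : i < k) (j l : κ) :
      QuadraticMap.polar q (r i j) (r k l) = 0 := by
    obtain hjl | rfl | hjl := lt_trichotomy j l
    · exact polar_of_lt hik hjl
    · exact eq_zero_of_eq_neg (swap i k j j)
    · rw [swap, polar_of_lt hik hjl, neg_zero]
  refine eq_zero_of_forall_polar_eq_zero hq hr fun i j k l => ?_
  obtain hik | rfl | hik := lt_trichotomy i k
  · exact polar_of_lt_left hik j l
  · exact eq_zero_of_eq_neg ((swap i i j l).trans (by rw [QuadraticMap.polar_comm]))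
  · rw [QuadraticMap.polar_comm, polar_of_lt_left hik]

theorem surjective_minorCoordinates_domRestrict [Finite ι] [Finite κ]
    (hr : ∀ i j a b, f a b (r i j) = e.coord i a * c.coord j b) :
    Function.Surjective ((minorCoordinates r).domRestrict (quadricsThroughProductCone f)) := by
  have := DFunLike.finite (Fin 2 ↪o ι)
  have := DFunLike.finite (Fin 2 ↪o κ)
  rw [← range_eq_top, eq_top_iff, ← (Pi.basisFun 𝕜 _).span_eq, Submodule.span_le]
  rintro _ ⟨p, rfl⟩
  exact ⟨⟨_, minor_mem_quadricsThroughProductCone _ _ _ _⟩,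
    (minorCoordinates_minor hr p).trans (Pi.basisFun_apply 𝕜 _ p).symm⟩

end Dimension

theorem finrank_quadricsThroughProductCone [NeZero (2 : 𝕜)] [FiniteDimensional 𝕜 P]
    [FiniteDimensional 𝕜 Q]
    (hf : ∀ (α : Dual 𝕜 P) (β : Dual 𝕜 Q), ∃ x, ∀ a b, f a b x = α a * β b) :
    finrank 𝕜 (quadricsThroughProductCone f) =
      (finrank 𝕜 P).choose 2 * (finrank 𝕜 Q).choose 2 := by
  let e := finBasis 𝕜 P
  let c := finBasis 𝕜 Q
  choose r hr using fun i j => hf (e.coord i) (c.coord j)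
  have card_orderEmbedding (n : ℕ) : Nat.card (Fin 2 ↪o Fin n) = n.choose 2 := by
    rw [Nat.card_congr Set.powersetCard.ofFinEmbEquiv, Set.powersetCard.card, Nat.card_fin]
  rw [(LinearEquiv.ofBijective _ ⟨injective_minorCoordinates_domRestrict hr,
    surjective_minorCoordinates_domRestrict hr⟩).finrank_eq, finrank_fintype_fun_eq_card,
    ← Nat.card_eq_fintype_card, Nat.card_prod, card_orderEmbedding, card_orderEmbedding]

end ProductCone

section Apolarity

variable {𝕜 K P Q : Type*} [Field 𝕜] [IsAlgClosed 𝕜] [NeZero (2 : 𝕜)] [AddCommGroup K] [Module 𝕜 K]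
  [FiniteDimensional 𝕜 K] [AddCommGroup P] [Module 𝕜 P] [FiniteDimensional 𝕜 P] [AddCommGroup Q]
  [Module 𝕜 Q] {f : P →ₗ[𝕜] Q →ₗ[𝕜] Dual 𝕜 K} {J : Submodule 𝕜 (QuadraticForm 𝕜 K)}
  {φ : Dual 𝕜 (QuadraticForm 𝕜 K)}

theorem finrank_lt_finrank_range_dualForm (hf : ∀ x ∈ productCone f, x = 0) (hP : finrank 𝕜 P ≤ 3)
    (hJ : ∀ a b c d, minor f a b c d ∈ J) (hφ : φ ∈ J.dualAnnihilator) (hφ₀ : φ ≠ 0) :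
    finrank 𝕜 P < finrank 𝕜 (range (dualForm φ)) := by
  by_contra! hrank
  have hapolar : IsApolar (dualForm φ) f :=
    isApolar_dualForm fun a b c d => (Submodule.mem_dualAnnihilator φ).mp hφ _ (hJ a b c d)
  obtain ⟨t, ht₀, ht⟩ := hapolar.exists_isProductForm (isSymm_dualForm φ)
    ((map_ne_zero_iff _ dualForm_injective).mpr hφ₀) hrank hP
  obtain ⟨x, hx⟩ := (evalEquiv 𝕜 K).surjective (dualForm φ t)
  rw [← hx] at ht ht₀
  exact ht₀ ((map_eq_zero_iff _ (evalEquiv 𝕜 K).injective).mpr (hf x ht))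

theorem finrank_range_dualForm_eq (hf : ∀ x ∈ productCone f, x = 0) (hP : finrank 𝕜 P ≤ 3)
    (hK : finrank 𝕜 K ≤ finrank 𝕜 P + 1) (hJ : ∀ a b c d, minor f a b c d ∈ J)
    (hφ : φ ∈ J.dualAnnihilator) (hφ₀ : φ ≠ 0) :
    finrank 𝕜 (range (dualForm φ)) = finrank 𝕜 K := by
  have hlt := finrank_lt_finrank_range_dualForm hf hP hJ hφ hφ₀
  have hle := Subspace.dual_finrank_eq (K := 𝕜) (V := K) ▸ finrank_range_le (dualForm φ)
  lia

theorem eq_top_of_forall_minor_mem (hf : ∀ x ∈ productCone f, x = 0) (hP : finrank 𝕜 P ≤ 3)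
    (hK : finrank 𝕜 K ≤ finrank 𝕜 P) (hJ : ∀ a b c d, minor f a b c d ∈ J) : J = ⊤ := by
  rw [← Subspace.dualAnnihilator_inj, Submodule.dualAnnihilator_top, Submodule.eq_bot_iff]
  intro φ hφ
  by_contra hφ₀
  have hlt := finrank_lt_finrank_range_dualForm hf hP hJ hφ hφ₀
  have heq := finrank_range_dualForm_eq hf hP (by lia) hJ hφ hφ₀
  lia

theorem finrank_dualAnnihilator_le_one [Nontrivial K] (hf : ∀ x ∈ productCone f, x = 0)
    (hP : finrank 𝕜 P ≤ 3) (hK : finrank 𝕜 K ≤ finrank 𝕜 P + 1)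
    (hJ : ∀ a b c d, minor f a b c d ∈ J) : finrank 𝕜 J.dualAnnihilator ≤ 1 := by
  rw [(J.dualAnnihilator.equivMapOfInjective dualForm dualForm_injective).finrank_eq]
  refine finrank_le_one_of_forall_injective Subspace.dual_finrank_eq.symm _ ?_
  rintro _ ⟨φ, hφ, rfl⟩ hne
  have hrank := finrank_range_dualForm_eq hf hP hK hJ hφ (by rintro rfl; exact hne (map_zero _))
  have hadd := finrank_range_add_finrank_ker (dualForm φ)
  rw [hrank, Subspace.dual_finrank_eq, Nat.add_eq_left, Submodule.finrank_eq_zero] at hadd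
  exact ker_eq_bot.mp hadd

theorem exists_eq_ker_of_forall_minor_mem [Nontrivial K] (hf : ∀ x ∈ productCone f, x = 0)
    (hP : finrank 𝕜 P ≤ 3) (hK : finrank 𝕜 K ≤ finrank 𝕜 P + 1)
    (hJ : ∀ a b c d, minor f a b c d ∈ J) (hJ_ne : J ≠ ⊤) :
    ∃ φ : Dual 𝕜 (QuadraticForm 𝕜 K), φ ≠ 0 ∧ J = ker φ ∧
      finrank 𝕜 (range (dualForm φ)) = finrank 𝕜 K := by
  obtain ⟨φ, hφ₀, hφ⟩ := J.exists_le_ker_of_lt_top hJ_ne.lt_top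
  have hann := finrank_dualAnnihilator_le_one hf hP hK hJ
  have hadd := Subspace.finrank_add_finrank_dualAnnihilator_eq J
  have hker := Dual.finrank_ker_add_one_of_ne_zero hφ₀
  exact ⟨φ, hφ₀, Submodule.eq_of_le_of_finrank_le hφ (by lia),
    finrank_range_dualForm_eq hf hP hK hJ ((Submodule.mem_dualAnnihilator φ).mpr fun _ hq => hφ hq)
      hφ₀⟩

section Range

variable {M : Type*} [AddCommGroup M] [Module 𝕜 M] [FiniteDimensional 𝕜 M]
  {ρ : M →ₗ[𝕜] QuadraticForm 𝕜 K}

theorem injective_of_forall_minor_mem_range [Nontrivial K] (hf : ∀ x ∈ productCone f, x = 0)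
    (hP : finrank 𝕜 P ≤ 3) (hK : finrank 𝕜 K ≤ finrank 𝕜 P + 1)
    (hρ : ∀ a b c d, minor f a b c d ∈ range ρ)
    (hM : finrank 𝕜 M < finrank 𝕜 (QuadraticForm 𝕜 K)) : Function.Injective ρ := by
  have hann := finrank_dualAnnihilator_le_one hf hP hK hρ
  have hadd := Subspace.finrank_add_finrank_dualAnnihilator_eq (range ρ)
  have hrank := finrank_range_add_finrank_ker ρ
  exact ker_eq_bot.mp (Submodule.finrank_eq_zero.mp (by lia : finrank 𝕜 (ker ρ) = 0))

end Range

end Apolarity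

section Trivectors

open exteriorPower

variable {R M : Type*} [CommRing R] [AddCommGroup M] [Module R M]

variable (R) in
/-- The trivector `x ∧ y ∧ z`, as a trilinear function. -/
def wedge : M →ₗ[R] M →ₗ[R] M →ₗ[R] ⋀[R]^3 M :=
  mk₂ R (fun x y => (AlternatingMap.ofSubsingleton R M _ (0 : Fin 1)).symm
      (((ιMulti R 3).curryLeft x).curryLeft y))
    (fun _ _ _ => by ext; simp) (fun _ _ _ => by ext; simp) (fun _ _ _ => by ext; simp)
    (fun _ _ _ => by ext; simp)

theorem wedge_apply (x y z : M) : wedge R x y z = ιMulti R 3 ![x, y, z] := by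
  refine congrArg (ιMulti R 3) (funext fun i => ?_)
  fin_cases i <;> rfl

theorem wedge_self (x z : M) : wedge R x x z = 0 := by
  rw [wedge_apply]
  exact (ιMulti R 3).map_eq_zero_of_eq _ (i := 0) (j := 1) rfl (by decide)

theorem wedge_self_right (x y : M) : wedge R x y y = 0 := by
  rw [wedge_apply]
  exact (ιMulti R 3).map_eq_zero_of_eq _ (i := 1) (j := 2) rfl (by decide)

theorem wedge_self_outer (x y : M) : wedge R x y x = 0 := by
  rw [wedge_apply]
  exact (ιMulti R 3).map_eq_zero_of_eq _ (i := 0) (j := 2) rfl (by decide)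

theorem wedge_swap (x y z : M) : wedge R x y z = -wedge R y x z :=
  IsAlt.neg (B := (wedge R).compr₂ (applyₗ z)) (fun x => wedge_self x z) y x |>.symm

theorem wedge_swap_right (x y z : M) : wedge R x y z = -wedge R x z y :=
  (IsAlt.neg (wedge_self_right x) z y).symm

theorem wedge_cycle (x y z : M) : wedge R x y z = wedge R y z x := by
  rw [wedge_swap, wedge_swap_right, neg_neg]

variable (R) in
/-- The linear map sending `v` to the sum of the `uᵢ₊₁ ∧ uᵢ₊₂ ∧ vᵢ`, with indices modulo `3`; when
`u` spans `U`, it parametrizes `T_U`. -/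
def tangentMap (u : Fin 3 → M) : (Fin 3 → M) →ₗ[R] ⋀[R]^3 M :=
  ∑ i, wedge R (u (i + 1)) (u (i + 2)) ∘ₗ proj i

theorem tangentMap_apply (u v : Fin 3 → M) : tangentMap R u v =
    wedge R (u 1) (u 2) (v 0) + wedge R (u 2) (u 0) (v 1) + wedge R (u 0) (u 1) (v 2) := by
  simp [tangentMap, Fin.sum_univ_three]

theorem wedge_sum_smul_sum_smul (u : Fin 3 → M) (p q : Fin 3 → R) (v : M) :
    wedge R (∑ i, p i • u i) (∑ i, q i • u i) v =
      tangentMap R u fun i => crossProduct p q i • v := by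
  simp only [Fin.sum_univ_three, map_add, map_smul, LinearMap.add_apply, LinearMap.smul_apply,
    wedge_self, tangentMap_apply, cross_apply, Matrix.cons_val]
  rw [wedge_swap (u 1) (u 0), wedge_swap (u 2) (u 1), wedge_swap (u 0) (u 2)]
  module

theorem pairingDual_wedge (α β γ : Dual R M) (x y z : M) :
    pairingDual R M 3 (wedge R α β γ) (wedge R x y z) =
      α x * (β y * γ z - β z * γ y) - α y * (β x * γ z - β z * γ x) +
        α z * (β x * γ y - β y * γ x) := by
  rw [wedge_apply, wedge_apply, pairingDual_ιMulti_ιMulti, Matrix.det_fin_three]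
  simp only [Matrix.of_apply, Matrix.cons_val]
  ring

theorem pairingDual_pluecker (α β γ δ ε : Dual R M) (x y z : M) :
    pairingDual R M 3 (wedge R α β δ) (wedge R x y z) *
          pairingDual R M 3 (wedge R α γ ε) (wedge R x y z) -
        pairingDual R M 3 (wedge R α β ε) (wedge R x y z) *
          pairingDual R M 3 (wedge R α γ δ) (wedge R x y z) =
      pairingDual R M 3 (wedge R α β γ) (wedge R x y z) *
        pairingDual R M 3 (wedge R α δ ε) (wedge R x y z) := by
  simp only [pairingDual_wedge]
  ring

end Trivectors

section Decomposable

variable {V : Type*} [AddCommGroup V] [Module ℂ V]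

theorem isDecomposable_wedge (x y z : V) : IsDecomposable (wedge ℂ x y z) :=
  ⟨![x, y, z], (wedge_apply x y z).symm⟩

theorem isDecomposable_wedge_add_of_ne_zero (x y z w : V) (c β γ : ℂ) {α : ℂ} (hα : α ≠ 0) :
    IsDecomposable (c • wedge ℂ x y z +
      (α • wedge ℂ y z w + β • wedge ℂ z x w + γ • wedge ℂ x y w)) := by
  convert isDecomposable_wedge (y + (-(β / α)) • x) (α • z + (-γ) • x) (w + (c / α) • x) using 1
  simp only [map_add, map_smul, LinearMap.add_apply, LinearMap.smul_apply, wedge_self,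
    wedge_self_right, wedge_self_outer]
  rw [← wedge_cycle x y z, wedge_swap y x w, wedge_swap x z w]
  match_scalars <;> field_simp

theorem isDecomposable_wedge_add (x y z w : V) (c α β γ : ℂ) :
    IsDecomposable (c • wedge ℂ x y z +
      (α • wedge ℂ y z w + β • wedge ℂ z x w + γ • wedge ℂ x y w)) := by
  by_cases hα : α = 0
  · by_cases hβ : β = 0
    · convert isDecomposable_wedge x y (c • z + γ • w) using 1
      simp [hα, hβ]
    · rw [wedge_cycle, add_rotate]
      exact isDecomposable_wedge_add_of_ne_zero y z x w c γ α hβ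
  · exact isDecomposable_wedge_add_of_ne_zero x y z w c β γ hα

theorem tangentSpace_span_range (u : Fin 3 → V) :
    tangentSpace (Submodule.span ℂ (Set.range u)) = range (tangentMap ℂ u) := by
  refine le_antisymm (Submodule.span_le.mpr ?_) ?_
  · rintro _ ⟨u₁, hu₁, u₂, hu₂, v, rfl⟩
    obtain ⟨p, rfl⟩ := (Submodule.mem_span_range_iff_exists_fun ℂ).mp hu₁
    obtain ⟨q, rfl⟩ := (Submodule.mem_span_range_iff_exists_fun ℂ).mp hu₂
    exact ⟨_, by rw [← wedge_sum_smul_sum_smul, wedge_apply]⟩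
  · rintro _ ⟨v, rfl⟩
    have hu i : u i ∈ Submodule.span ℂ (Set.range u) := Submodule.subset_span ⟨i, rfl⟩
    have hmem i j w : wedge ℂ (u i) (u j) w ∈ tangentSpace (Submodule.span ℂ (Set.range u)) :=
      Submodule.subset_span ⟨u i, hu i, u j, hu j, w, wedge_apply _ _ _⟩
    rw [tangentMap_apply]
    exact add_mem (add_mem (hmem _ _ _) (hmem _ _ _)) (hmem _ _ _)

end Decomposable

section ConeForm

open exteriorPower

variable {V : Type*} [AddCommGroup V] [Module ℂ V]

/-- The Plücker coordinates `(i, ℓ) ↦ (eᵢ₊₁ ∧ eᵢ₊₂ ∧ ℓ)(x)` of a trivector `x`, with indices modulo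
`3`, extended linearly in `i`. -/
def plueckerForm (e : Fin 3 → Dual ℂ V) :
    (Fin 3 → ℂ) →ₗ[ℂ] Dual ℂ V →ₗ[ℂ] Dual ℂ (⋀[ℂ]^3 V) :=
  mk₂ ℂ (fun a ℓ => pairingDual ℂ V 3 (tangentMap ℂ e fun i => a i • ℓ))
    (fun a b ℓ => by simp only [← map_add, ← Pi.add_def, Pi.add_apply, add_smul])
    (fun c a ℓ => by simp only [← map_smul, ← Pi.smul_def, Pi.smul_apply, smul_assoc])
    (fun a ℓ m => by simp only [← map_add, ← Pi.add_def, smul_add])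
    (fun c a ℓ => by simp only [← map_smul, Pi.smul_def, smul_comm c])

theorem plueckerForm_apply (e : Fin 3 → Dual ℂ V) (a : Fin 3 → ℂ) (ℓ : Dual ℂ V) :
    plueckerForm e a ℓ = pairingDual ℂ V 3 (tangentMap ℂ e fun i => a i • ℓ) := rfl

theorem plueckerForm_single (e : Fin 3 → Dual ℂ V) (i : Fin 3) (ℓ : Dual ℂ V) :
    plueckerForm e (Pi.single i 1) ℓ =
      pairingDual ℂ V 3 (wedge ℂ (e (i + 1)) (e (i + 2)) ℓ) := by
  fin_cases i <;> simp [plueckerForm_apply, tangentMap_apply]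

variable {U : Submodule ℂ V}

theorem pairingDual_wedge_eq_zero {α δ ε : Dual ℂ V} (hδ : δ ∈ U.dualAnnihilator)
    (hε : ε ∈ U.dualAnnihilator) {x : ⋀[ℂ]^3 V} (hx : x ∈ tangentSpace U) :
    pairingDual ℂ V 3 (wedge ℂ α δ ε) x = 0 := by
  rw [Submodule.mem_dualAnnihilator] at hδ hε
  suffices tangentSpace U ≤ ker (pairingDual ℂ V 3 (wedge ℂ α δ ε)) from this hx
  refine Submodule.span_le.mpr ?_
  rintro _ ⟨u₁, hu₁, u₂, hu₂, v, rfl⟩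
  simp [← wedge_apply, pairingDual_wedge, hδ _ hu₁, hδ _ hu₂, hε _ hu₁, hε _ hu₂]

variable (U) in
/-- The bilinear form `(ℂ³)ᵛ × (V / U)ᵛ → ℂ` attached to every vector of `T_U`, as a family of
linear forms on `T_U`. -/
def coneForm (e : Fin 3 → Dual ℂ V) :
    (Fin 3 → ℂ) →ₗ[ℂ] U.dualAnnihilator →ₗ[ℂ] Dual ℂ (tangentSpace U) :=
  ((plueckerForm e).compl₂ U.dualAnnihilator.subtype).compr₂ (tangentSpace U).subtype.dualMap

theorem coneForm_apply (e : Fin 3 → Dual ℂ V) (a : Fin 3 → ℂ) (ℓ : U.dualAnnihilator)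
    (x : tangentSpace U) : coneForm U e a ℓ x = plueckerForm e a ℓ x := rfl

theorem coneForm_tangentMap {e : Fin 3 → Dual ℂ V} {u : Fin 3 → U}
    (heu : ∀ i j, e i (u j) = if i = j then 1 else 0) (a : Fin 3 → ℂ) (ℓ : U.dualAnnihilator)
    (v : Fin 3 → V) (hv : tangentMap ℂ (fun i => (u i : V)) v ∈ tangentSpace U) :
    coneForm U e a ℓ ⟨_, hv⟩ = ∑ i, a i * (ℓ : Dual ℂ V) (v i) := by
  have hℓ i : (ℓ : Dual ℂ V) (u i) = 0 := (Submodule.mem_dualAnnihilator _).mp ℓ.2 _ (u i).2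
  simp [coneForm_apply, plueckerForm_apply, tangentMap_apply, pairingDual_wedge, heu, hℓ,
    Fin.sum_univ_three]

theorem mem_productCone_of_isDecomposable {e : Fin 3 → Dual ℂ V} {x : tangentSpace U}
    (hx : IsDecomposable (x : ⋀[ℂ]^3 V)) : x ∈ productCone (coneForm U e) := by
  obtain ⟨x, hxU⟩ := x
  obtain ⟨v, rfl⟩ := hx
  have hv : ιMulti ℂ 3 v = wedge ℂ (v 0) (v 1) (v 2) := by
    rw [wedge_apply]
    exact congrArg _ (List.ofFn_inj.mp rfl)
  let F (i : Fin 3) (ℓ : U.dualAnnihilator) := plueckerForm e (Pi.single i 1) ℓ (ιMulti ℂ 3 v)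
  have succ_row (i : Fin 3) (b d : U.dualAnnihilator) :
      F i b * F (i + 1) d = F i d * F (i + 1) b := by
    have h := pairingDual_pluecker (e (i + 2)) (e (i + 1)) (e i) b d (v 0) (v 1) (v 2)
    have h₂ : i + 1 + 1 = i + 2 := by lia
    have h₃ : i + 1 + 2 = i := by lia
    have neg (ℓ : Dual ℂ V) : pairingDual ℂ V 3 (wedge ℂ (e (i + 1)) (e (i + 2)) ℓ) =
        -pairingDual ℂ V 3 (wedge ℂ (e (i + 2)) (e (i + 1)) ℓ) := by
      rw [wedge_swap, map_neg]
    rw [← hv, pairingDual_wedge_eq_zero b.2 d.2 hxU, mul_zero] at h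
    simp only [F, plueckerForm_single, h₂, h₃, neg, LinearMap.neg_apply]
    linear_combination -h
  refine isProductForm_of_basis (Pi.basisFun ℂ (Fin 3)) fun i j b d => ?_
  simp only [Pi.basisFun_apply]
  change F i b * F j d = F i d * F j b
  obtain rfl | rfl | rfl : j = i ∨ j = i + 1 ∨ i = j + 1 := by lia
  · exact mul_comm _ _
  · exact succ_row i b d
  · rw [mul_comm, ← succ_row, mul_comm]

theorem isDecomposable_tangentMap {u v : Fin 3 → V} {w : V} {α : Fin 3 → ℂ}
    (h : ∀ i, v i - α i • w ∈ Submodule.span ℂ (Set.range u)) :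
    IsDecomposable (tangentMap ℂ u v) := by
  choose c hc using fun i => (Submodule.mem_span_range_iff_exists_fun ℂ).mp (h i)
  convert isDecomposable_wedge_add (u 0) (u 1) (u 2) w (∑ i, c i i) (α 0) (α 1) (α 2) using 1
  obtain rfl : v = fun i => ∑ j, c i j • u j + α i • w :=
    funext fun i => by rw [hc, sub_add_cancel]
  simp only [tangentMap_apply, Fin.sum_univ_three, map_add, map_smul, wedge_self_right,
    wedge_self_outer]
  rw [← wedge_cycle (u 0) (u 1) (u 2), ← wedge_cycle (u 2) (u 0) (u 1),
    wedge_cycle (u 2) (u 0) (u 1)]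
  module

theorem span_range_coe_basis {ι : Type*} (u : Basis ι ℂ U) :
    Submodule.span ℂ (Set.range fun i => (u i : V)) = U := by
  rw [Set.range_comp' Subtype.val u, ← Submodule.coe_subtype, ← Submodule.map_span, u.span_eq,
    Submodule.map_subtype_top]

theorem range_tangentMap_basis (u : Basis (Fin 3) ℂ U) :
    range (tangentMap ℂ fun i => (u i : V)) = tangentSpace U := by
  rw [← tangentSpace_span_range, span_range_coe_basis]

theorem isDecomposable_of_mem_productCone (u : Basis (Fin 3) ℂ U) {e : Fin 3 → Dual ℂ V}
    (heu : ∀ i j, e i (u j) = if i = j then 1 else 0) {x : tangentSpace U}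
    (hx : x ∈ productCone (coneForm U e)) : IsDecomposable (x : ⋀[ℂ]^3 V) := by
  obtain ⟨α, β, h⟩ := mem_productCone.mp hx
  obtain ⟨x, hxU⟩ := x
  rw [← range_tangentMap_basis u] at hxU
  obtain ⟨v, rfl⟩ := hxU
  have hv (i : Fin 3) (ℓ : U.dualAnnihilator) : (ℓ : Dual ℂ V) (v i) = α (Pi.single i 1) * β ℓ := by
    rw [← h, coneForm_tangentMap heu]
    simp [Pi.single_apply]
  obtain ⟨w, hw⟩ : ∃ w : V, ∀ i, ∀ ℓ : U.dualAnnihilator,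
      (ℓ : Dual ℂ V) (v i - α (Pi.single i 1) • w) = 0 := by
    by_cases hα : ∀ i, α (Pi.single i 1) = 0
    · exact ⟨0, fun i ℓ => by simp [hv, hα]⟩
    · push Not at hα
      obtain ⟨i₀, hi₀⟩ := hα
      refine ⟨(α (Pi.single i₀ 1))⁻¹ • v i₀, fun i ℓ => ?_⟩
      simp [hv, hi₀]
  refine isDecomposable_tangentMap (w := w) (α := fun i => α (Pi.single i 1)) fun i => ?_
  rw [span_range_coe_basis u]
  exact (Subspace.forall_mem_dualAnnihilator_apply_eq_zero_iff U _).mp fun ℓ hℓ => hw i ⟨ℓ, hℓ⟩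

theorem exists_coneForm_eq [FiniteDimensional ℂ V] (u : Basis (Fin 3) ℂ U) {e : Fin 3 → Dual ℂ V}
    (heu : ∀ i j, e i (u j) = if i = j then 1 else 0)
    (α : Dual ℂ (Fin 3 → ℂ)) (β : Dual ℂ U.dualAnnihilator) :
    ∃ x, ∀ a ℓ, coneForm U e a ℓ x = α a * β ℓ := by
  obtain ⟨w, hw⟩ : ∃ w : V, ∀ ℓ : U.dualAnnihilator, β ℓ = (ℓ : Dual ℂ V) w := by
    obtain ⟨β', rfl⟩ := Subspace.dualRestrict_surjective β
    obtain ⟨w, rfl⟩ := (evalEquiv ℂ V).surjective β'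
    exact ⟨w, fun _ => rfl⟩
  let v : Fin 3 → V := fun i => α (Pi.single i 1) • w
  have hv : tangentMap ℂ (fun i => (u i : V)) v ∈ tangentSpace U :=
    range_tangentMap_basis u ▸ mem_range_self _ v
  have hα a : α a = ∑ i, a i * α (Pi.single i 1) := by
    simpa using congrArg α ((Pi.basisFun ℂ (Fin 3)).sum_equivFun a).symm
  refine ⟨⟨_, hv⟩, fun a ℓ => ?_⟩
  rw [coneForm_tangentMap heu, hw, hα]
  simp [v, mul_assoc, Finset.sum_mul]

theorem exists_dual_family (u : Basis (Fin 3) ℂ U) :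
    ∃ e : Fin 3 → Dual ℂ V, ∀ i j, e i (u j) = if i = j then 1 else 0 := by
  choose e he using fun i => (u.coord i).exists_extend
  refine ⟨e, fun i j => (LinearMap.congr_fun (he i) (u j)).trans ?_⟩
  simp [Finsupp.single_apply, eq_comm]

end ConeForm

section Restriction

variable {V : Type*} [AddCommGroup V] [Module ℂ V] {A : Submodule ℂ (⋀[ℂ]^3 V)}
  {U : Submodule ℂ V}

-- Instance search does not find these: it fails to unify the additive monoid of `S` with the one
-- underlying its additive group.
instance (S : Submodule ℂ (⋀[ℂ]^3 V)) : AddCommGroup (QuadraticForm ℂ S) :=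
  QuadraticMap.instAddCommGroup (M := S)

instance [FiniteDimensional ℂ V] (S : Submodule ℂ (⋀[ℂ]^3 V)) :
    FiniteDimensional ℂ (QuadraticForm ℂ S) :=
  finiteDimensional_quadraticForm (K := S)

theorem quadricsThroughProductCone_coneForm (u : Basis (Fin 3) ℂ U) {e : Fin 3 → Dual ℂ V}
    (heu : ∀ i j, e i (u j) = if i = j then 1 else 0) :
    quadricsThroughProductCone (𝕜 := ℂ) (S := tangentSpace U) (coneForm U e) =
      quadricsThroughCone U :=
  le_antisymm
    (fun (q : QuadraticForm ℂ (tangentSpace U))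
        (hq : ∀ x ∈ productCone (𝕜 := ℂ) (S := tangentSpace U) (coneForm U e), q x = 0) x hx =>
      hq x (mem_productCone_of_isDecomposable hx))
    fun _ hq x hx => hq x (isDecomposable_of_mem_productCone u heu hx)

theorem finrank_quadricsThroughCone [FiniteDimensional ℂ V] (hU : finrank ℂ U = 3) :
    finrank ℂ (quadricsThroughCone U) = 3 * (finrank ℂ V - 3).choose 2 := by
  let u := finBasisOfFinrankEq ℂ U hU
  obtain ⟨e, heu⟩ := exists_dual_family u
  have hann := Subspace.finrank_add_finrank_dualAnnihilator_eq U
  rw [← quadricsThroughProductCone_coneForm u heu,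
    finrank_quadricsThroughProductCone (𝕜 := ℂ) (S := tangentSpace U) (exists_coneForm_eq u heu),
    finrank_fin_fun, Nat.choose_two_right 3,
    show finrank ℂ U.dualAnnihilator = finrank ℂ V - 3 by lia]

theorem exists_forms_on_interTangent (hU : finrank ℂ U = 3)
    (hdec : HasNoDecomposable (interTangent A U)) :
    ∃ f : (Fin 3 → ℂ) →ₗ[ℂ] U.dualAnnihilator →ₗ[ℂ] Dual ℂ (interTangent A U),
      (∀ x ∈ productCone (𝕜 := ℂ) (S := interTangent A U) f, x = 0) ∧
      ∀ a b c d, minor (𝕜 := ℂ) (S := interTangent A U) f a b c d ∈ range (restrictionMap A U) := by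
  have : FiniteDimensional ℂ U := Module.finite_of_finrank_eq_succ hU
  let u := finBasisOfFinrankEq ℂ U hU
  obtain ⟨e, heu⟩ := exists_dual_family u
  let ι : interTangent A U →ₗ[ℂ] tangentSpace U := Submodule.inclusion inf_le_right
  refine ⟨(coneForm U e).compr₂ ι.dualMap, fun x hx => ?_, fun a b c d => ?_⟩
  · exact Subtype.ext (hdec x x.2 (isDecomposable_of_mem_productCone u heu (x := ι x) hx))
  · have hmem := minor_mem_quadricsThroughProductCone (𝕜 := ℂ) (S := tangentSpace U)
      (f := coneForm U e) a b c d
    rw [quadricsThroughProductCone_coneForm u heu] at hmem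
    exact ⟨⟨_, hmem⟩, rfl⟩

variable [FiniteDimensional ℂ V]

theorem surjective_restrictionMap (hU : finrank ℂ U = 3)
    (hdec : HasNoDecomposable (interTangent A U)) (hK : finrank ℂ (interTangent A U) ≤ 3) :
    Function.Surjective (restrictionMap A U) := by
  obtain ⟨f, hf, hJ⟩ := exists_forms_on_interTangent hU hdec
  have hP := finrank_fin_fun ℂ (n := 3)
  exact range_eq_top.mp (eq_top_of_forall_minor_mem hf hP.le (hK.trans hP.ge) hJ)

theorem finrank_ker_restrictionMap (hU : finrank ℂ U = 3)
    (hdec : HasNoDecomposable (interTangent A U)) (hK : finrank ℂ (interTangent A U) ≤ 3) :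
    finrank ℂ (ker (restrictionMap A U)) = 3 * (finrank ℂ V - 3).choose 2 -
      finrank ℂ (interTangent A U) * (finrank ℂ (interTangent A U) + 1) / 2 := by
  have hadd := finrank_range_add_finrank_ker (restrictionMap A U)
  rw [range_eq_top.mpr (surjective_restrictionMap hU hdec hK), finrank_top,
    finrank_quadraticForm (K := interTangent A U), finrank_quadricsThroughCone hU,
    Nat.choose_two_right, Nat.add_sub_cancel, mul_comm (_ + 1)] at hadd
  lia

theorem finrank_quadricsThroughCone_lt (hV : finrank ℂ V = 6) (hU : finrank ℂ U = 3)
    (hK : finrank ℂ (interTangent A U) = 4) :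
    finrank ℂ (quadricsThroughCone U) < finrank ℂ (QuadraticForm ℂ (interTangent A U)) := by
  rw [finrank_quadricsThroughCone hU, hV, finrank_quadraticForm (K := interTangent A U), hK]
  decide

theorem injective_restrictionMap (hV : finrank ℂ V = 6) (hU : finrank ℂ U = 3)
    (hdec : HasNoDecomposable (interTangent A U)) (hK : finrank ℂ (interTangent A U) = 4) :
    Function.Injective (restrictionMap A U) := by
  obtain ⟨f, hf, hJ⟩ := exists_forms_on_interTangent hU hdec
  have hP := finrank_fin_fun ℂ (n := 3)
  have : Nontrivial (interTangent A U) := nontrivial_of_finrank_eq_succ hK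
  exact injective_of_forall_minor_mem_range hf hP.le (by lia) hJ
    (finrank_quadricsThroughCone_lt hV hU hK)

theorem exists_range_restrictionMap_eq_ker (hV : finrank ℂ V = 6) (hU : finrank ℂ U = 3)
    (hdec : HasNoDecomposable (interTangent A U)) (hK : finrank ℂ (interTangent A U) = 4) :
    ∃ φ : Dual ℂ (QuadraticForm ℂ (interTangent A U)), φ ≠ 0 ∧ range (restrictionMap A U) = ker φ ∧
      finrank ℂ (range (dualForm (K := interTangent A U) φ)) = 4 := by
  obtain ⟨f, hf, hJ⟩ := exists_forms_on_interTangent hU hdec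
  have hP := finrank_fin_fun ℂ (n := 3)
  have : Nontrivial (interTangent A U) := nontrivial_of_finrank_eq_succ hK
  have hrange : range (restrictionMap A U) ≠ ⊤ := fun h =>
    (finrank_quadricsThroughCone_lt hV hU hK).not_ge <|
      (finrank_top ℂ _).symm.trans_le (h ▸ finrank_range_le (restrictionMap A U))
  rw [← hK]
  exact exists_eq_ker_of_forall_minor_mem (K := interTangent A U) hf hP.le (by lia) hJ hrange

theorem isCoatom_range_restrictionMap (hV : finrank ℂ V = 6) (hU : finrank ℂ U = 3)
    (hdec : HasNoDecomposable (interTangent A U)) (hK : finrank ℂ (interTangent A U) = 4) :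
    IsCoatom (range (restrictionMap A U)) := by
  obtain ⟨φ, hφ₀, hφ, -⟩ := exists_range_restrictionMap_eq_ker hV hU hdec hK
  rw [hφ]
  exact isCoatom_ker_of_surjective (LinearMap.surjective hφ₀)

theorem exists_range_restrictionMap_eq_hyperplaneOf (hV : finrank ℂ V = 6) (hU : finrank ℂ U = 3)
    (hdec : HasNoDecomposable (interTangent A U)) (hK : finrank ℂ (interTangent A U) = 4) :
    ∃ p : symTensors (interTangent A U),
      range (restrictionMap A U) = hyperplaneOf (K := interTangent A U) p ∧
        tensorRank (K := interTangent A U) p = 4 := by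
  obtain ⟨φ, -, hφ, hrank⟩ := exists_range_restrictionMap_eq_ker hV hU hdec hK
  obtain ⟨p, rfl, hp⟩ := exists_symTensor_evalAtTensor_eq (K := interTangent A U) φ
  exact ⟨p, hφ, hp.trans hrank⟩

end Restriction

end EPWCube

end

theorem mainTheorem7_general {V : Type*} [AddCommGroup V] [Module ℂ V] [FiniteDimensional ℂ V]
    {A : Submodule ℂ (⋀[ℂ]^3 V)} {U₀ : Submodule ℂ V} (hU₀ : Module.finrank ℂ U₀ = 3)
    (hdec : EPWCube.HasNoDecomposable (EPWCube.interTangent A U₀))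
    {k : ℕ} (hk : Module.finrank ℂ (EPWCube.interTangent A U₀) = k) :
    (k ≤ 3 →
      Function.Surjective (EPWCube.restrictionMap A U₀) ∧
      Module.finrank ℂ (LinearMap.ker (EPWCube.restrictionMap A U₀)) =
        3 * (Module.finrank ℂ V - 3).choose 2 - k * (k + 1) / 2) ∧
    (Module.finrank ℂ V = 6 → k = 4 →
      Function.Injective (EPWCube.restrictionMap A U₀) ∧
      IsCoatom (LinearMap.range (EPWCube.restrictionMap A U₀)) ∧
      ∃ p : EPWCube.symTensors (EPWCube.interTangent A U₀),
        LinearMap.range (EPWCube.restrictionMap A U₀) =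
          EPWCube.hyperplaneOf (K := EPWCube.interTangent A U₀) p ∧
        EPWCube.tensorRank (K := EPWCube.interTangent A U₀) p = 4) := by
  subst hk
  exact ⟨fun hk => ⟨EPWCube.surjective_restrictionMap hU₀ hdec hk,
      EPWCube.finrank_ker_restrictionMap hU₀ hdec hk⟩,
    fun hV hk => ⟨EPWCube.injective_restrictionMap hV hU₀ hdec hk,
      EPWCube.isCoatom_range_restrictionMap hV hU₀ hdec hk,
      EPWCube.exists_range_restrictionMap_eq_hyperplaneOf hV hU₀ hdec hk⟩⟩

theorem mainTheorem7 {V : Type*} [AddCommGroup V] [Module ℂ V]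
    (hV : Module.finrank ℂ V = 6)
    (A : Submodule ℂ (⋀[ℂ]^3 V)) (hA : EPWCube.IsLagrangian A)
    (hdec : EPWCube.HasNoDecomposable A)
    (k : ℕ) (hk : k ∈ ({1, 2, 3, 4} : Set ℕ))
    (U₀ : Submodule ℂ V) (hU₀ : U₀ ∈ EPWCube.stratum A k) :
    (k ≤ 3 →
      Function.Surjective (EPWCube.restrictionMap A U₀) ∧
      Module.finrank ℂ (LinearMap.ker (EPWCube.restrictionMap A U₀)) = 9 - k * (k + 1) / 2) ∧
    (k = 4 →
      Function.Injective (EPWCube.restrictionMap A U₀) ∧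
      IsCoatom (LinearMap.range (EPWCube.restrictionMap A U₀)) ∧
      ∃ p : EPWCube.symTensors (EPWCube.interTangent A U₀),
        LinearMap.range (EPWCube.restrictionMap A U₀) =
          EPWCube.hyperplaneOf (K := EPWCube.interTangent A U₀) p ∧
        EPWCube.tensorRank (K := EPWCube.interTangent A U₀) p = 4) := by
  have : FiniteDimensional ℂ V := Module.finite_of_finrank_eq_succ hV
  simpa [hV] using mainTheorem7_general hU₀.1 (fun x hx => hdec x hx.1) hU₀.2
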